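/- Fix an integer $k\ge 1$ and let $\mathbb{H}^k=\mathbb{R}^{2k}\times\mathbb{R}$ be the Heisenberg group with group law $(v,t)\cdot(v',t')=(v+v',\,t+t'+\tfrac12\omega(v,v'))$, where $\omega(v,v')=\sum_{j=1}^k (v_jv'_{j+k}-v_{j+k}v'_j)$, Korányi norm $\|(v,t)\|=(|v|^4+16t^2)^{1/4}$ and Korányi metric $d(p,q)=\|q^{-1}\cdot p\|$. All metric notions refer to $d$: $B(p,r)$ is the closed ball, $\operatorname{dist}$ and $\operatorname{diam}$ are the distance to a set and the diameter, and $\mathcal{H}^{2k+1}$ is the $(2k+1)$-dimensional Hausdorff measure. A closed set $E\subset\mathbb{H}^k$ is called Ahlfors-regular if there are constants $C,c>0$ such that $\mathcal{H}^{2k+1}(B(p,r)\cap E)\le C r^{2k+1}$ for all $p\in\mathbb{H}^k$ and $r>0$, and $\mathcal{H}^{2k+1}(B(p,r)\cap E)\ge c\, r^{2k+1}$ for all $p\in E$ and $0<r<\operatorname{diam}E$ (where $\operatorname{diam}E=\infty$ if $E$ is unbounded). A hyperplane is an affine hyperplane of the real vector space $\mathbb{R}^{2k}\times\mathbb{R}$.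 A vertical hyperplane is a set of the form $p'\cdot(\nu^\perp\times\mathbb{R})$ with $p'\in\mathbb{H}^k$, $\nu\in\mathbb{R}^{2k}$, $|\nu|=1$, where $\nu^\perp$ is the Euclidean orthogonal complement of $\nu$ in $\mathbb{R}^{2k}$. For $E\subset\mathbb{H}^k$, $p\in E$ and $s>0$ set $$b\beta_E(p,s)=\inf_P\Big\{\sup_{q\in B(p,s)\cap E}\frac{\operatorname{dist}(q,P)}{s}+\sup_{q\in B(p,s)\cap P}\frac{\operatorname{dist}(q,E)}{s}\Big\},$$ where $P$ runs over all hyperplanes and a supremum over the empty set is $0$; let $b\beta_{v,E}(p,s)$ be the same quantity with $P$ running over all vertical hyperplanes only. We say that $E$ satisfies the bilateral weak geometric lemma (BWGL) for arbitrary hyperplanes if for every $\epsilon>0$ there is a constant $C(\epsilon)>0$ such that $$\int_0^R \mathcal{H}^{2k+1}\big(\{q\in E\cap B(p,R): b\beta_E(q,s)>\epsilon\}\big)\,\frac{ds}{s}\le C(\epsilon)\,R^{2k+1}\qquad\text{for all } p\in E,\ R>0,$$ and that $E$ satisfies BWGL for vertical hyperplanes if the same holds with $b\beta_{v,E}$ in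 place of $b\beta_E$. Theorem. Let $E\subset\mathbb{H}^k$ be a closed Ahlfors-regular set. Then $E$ satisfies BWGL for vertical hyperplanes if and only if it satisfies BWGL for arbitrary hyperplanes. -/

import Mathlib

open scoped ENNReal

/-- The Heisenberg group `ℍ^k`, identified with `ℝ^{2k} × ℝ`. The coordinates of `ℝ^{2k}` are
indexed by `Fin k ⊕ Fin k`: `Sum.inl j` is the index `j` and `Sum.inr j` is the index `j + k`. -/
@[ext]
structure Heis (k : ℕ) where
  v : EuclideanSpace ℝ (Fin k ⊕ Fin k)
  t : ℝ

namespace Heis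

variable {k : ℕ}

/-- The symplectic form `ω(v,w) = ∑ⱼ (v_j w_{j+k} - v_{j+k} w_j)`. -/
noncomputable def omega (v w : EuclideanSpace ℝ (Fin k ⊕ Fin k)) : ℝ :=
  ∑ j : Fin k, (v (Sum.inl j) * w (Sum.inr j) - v (Sum.inr j) * w (Sum.inl j))

lemma omega_add_left (u v w : EuclideanSpace ℝ (Fin k ⊕ Fin k)) :
    omega (u + v) w = omega u w + omega v w := by
  simp only [omega, PiLp.add_apply, ← Finset.sum_add_distrib]
  exact Finset.sum_congr rfl fun j _ => by ring

lemma omega_add_right (u v w : EuclideanSpace ℝ (Fin k ⊕ Fin k)) :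
    omega u (v + w) = omega u v + omega u w := by
  simp only [omega, PiLp.add_apply, ← Finset.sum_add_distrib]
  exact Finset.sum_congr rfl fun j _ => by ring

lemma omega_neg_left (v w : EuclideanSpace ℝ (Fin k ⊕ Fin k)) :
    omega (-v) w = -omega v w := by
  simp only [omega, PiLp.neg_apply, ← Finset.sum_neg_distrib]
  exact Finset.sum_congr rfl fun j _ => by ring

lemma omega_self (v : EuclideanSpace ℝ (Fin k ⊕ Fin k)) : omega v v = 0 := by
  simp only [omega]
  exact Finset.sum_eq_zero fun j _ => by ring

lemma omega_zero_left (v : EuclideanSpace ℝ (Fin k ⊕ Fin k)) : omega 0 v = 0 := by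
  simp [omega]

lemma omega_zero_right (v : EuclideanSpace ℝ (Fin k ⊕ Fin k)) : omega v 0 = 0 := by
  simp [omega]

noncomputable instance : Mul (Heis k) :=
  ⟨fun p q => ⟨p.v + q.v, p.t + q.t + omega p.v q.v / 2⟩⟩

noncomputable instance : One (Heis k) := ⟨⟨0, 0⟩⟩

noncomputable instance : Inv (Heis k) := ⟨fun p => ⟨-p.v, -p.t⟩⟩

@[simp] lemma mul_v (p q : Heis k) : (p * q).v = p.v + q.v := rfl
@[simp] lemma mul_t (p q : Heis k) : (p * q).t = p.t + q.t + omega p.v q.v / 2 := rfl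
@[simp] lemma one_v : (1 : Heis k).v = 0 := rfl
@[simp] lemma one_t : (1 : Heis k).t = 0 := rfl
@[simp] lemma inv_v (p : Heis k) : (p⁻¹).v = -p.v := rfl
@[simp] lemma inv_t (p : Heis k) : (p⁻¹).t = -p.t := rfl

noncomputable instance : Group (Heis k) :=
  Group.ofLeftAxioms
    (fun p q r => by
      ext1
      · simp [add_assoc]
      · simp only [mul_v, mul_t, omega_add_left, omega_add_right]; ring)
    (fun p => by
      ext1
      · simp
      · simp [omega_zero_left])
    (fun p => by
      ext1
      · simp
      · simp [omega_neg_left, omega_self])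

/-- The Korányi norm `‖(v,t)‖ = (|v|⁴ + 16 t²)^{1/4}`. -/
noncomputable def koranyi (p : Heis k) : ℝ := (‖p.v‖ ^ 4 + 16 * p.t ^ 2) ^ (1 / 4 : ℝ)

lemma koranyi_nonneg (p : Heis k) : 0 ≤ koranyi p := by
  unfold koranyi; positivity

lemma koranyi_pow_four (p : Heis k) : koranyi p ^ 4 = ‖p.v‖ ^ 4 + 16 * p.t ^ 2 := by
  unfold koranyi
  rw [← Real.rpow_natCast, ← Real.rpow_mul (by positivity)]
  norm_num

lemma inner_sq_add_omega_sq_le (v w : EuclideanSpace ℝ (Fin k ⊕ Fin k)) :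
    inner ℝ v w ^ 2 + omega v w ^ 2 ≤ (‖v‖ * ‖w‖) ^ 2 := by
  let c : EuclideanSpace ℝ (Fin k ⊕ Fin k) → EuclideanSpace ℂ (Fin k) := fun u =>
    WithLp.toLp 2 fun j => (⟨u (Sum.inl j), u (Sum.inr j)⟩ : ℂ)
  have hn : ∀ u, ‖c u‖ = ‖u‖ := by
    intro u
    rw [EuclideanSpace.norm_eq, EuclideanSpace.norm_eq]
    congr 1
    rw [Fintype.sum_sum_type, ← Finset.sum_add_distrib]
    refine Finset.sum_congr rfl fun j _ => ?_
    simp only [c, Complex.sq_norm, Complex.normSq_mk, Real.norm_eq_abs, sq_abs]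
    ring
  have hi : inner ℂ (c v) (c w) = (⟨inner ℝ v w, omega v w⟩ : ℂ) := by
    apply Complex.ext
    · simp [c, PiLp.inner_apply, Fintype.sum_sum_type, Finset.sum_add_distrib, mul_comm]
    · simp only [c, PiLp.inner_apply, omega, Complex.im_sum]
      refine Finset.sum_congr rfl fun j _ => ?_
      simp
      ring
  have h := norm_inner_le_norm (𝕜 := ℂ) (c v) (c w)
  rw [hi, hn, hn] at h
  have h2 := pow_le_pow_left₀ (norm_nonneg _) h 2
  rw [Complex.sq_norm, Complex.normSq_mk] at h2
  linarith

lemma koranyi_mul_le (p q : Heis k) : koranyi (p * q) ≤ koranyi p + koranyi q := by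
  have hp := koranyi_nonneg p
  have hq := koranyi_nonneg q
  have hn : ∀ x : Heis k, ‖(⟨‖x.v‖ ^ 2, 4 * x.t⟩ : ℂ)‖ = koranyi x ^ 2 := by
    intro x
    have h1 : ‖(⟨‖x.v‖ ^ 2, 4 * x.t⟩ : ℂ)‖ ^ 2 = (koranyi x ^ 2) ^ 2 := by
      rw [Complex.sq_norm, Complex.normSq_mk, ← pow_mul, koranyi_pow_four]; ring
    exact (pow_left_inj₀ (norm_nonneg _) (by positivity) two_ne_zero).1 h1
  have hle : ∀ x : Heis k, ‖x.v‖ ≤ koranyi x := by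
    intro x
    refine le_of_pow_le_pow_left₀ (n := 4) (by norm_num) (koranyi_nonneg x) ?_
    rw [koranyi_pow_four]; nlinarith [sq_nonneg x.t]
  have hsum : (⟨‖(p * q).v‖ ^ 2, 4 * (p * q).t⟩ : ℂ) =
      ⟨‖p.v‖ ^ 2, 4 * p.t⟩ + ⟨‖q.v‖ ^ 2, 4 * q.t⟩ +
        2 * ⟨inner ℝ p.v q.v, omega p.v q.v⟩ := by
    apply Complex.ext
    · simp [norm_add_sq_real]; ring
    · simp; ring
  have hcs : ‖(⟨inner ℝ p.v q.v, omega p.v q.v⟩ : ℂ)‖ ≤ ‖p.v‖ * ‖q.v‖ := by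
    refine le_of_pow_le_pow_left₀ (n := 2) (by norm_num) (by positivity) ?_
    rw [Complex.sq_norm, Complex.normSq_mk]
    have := inner_sq_add_omega_sq_le p.v q.v
    linarith
  have hpq : ‖p.v‖ * ‖q.v‖ ≤ koranyi p * koranyi q :=
    mul_le_mul (hle p) (hle q) (norm_nonneg _) hp
  have h : koranyi (p * q) ^ 2 ≤ (koranyi p + koranyi q) ^ 2 := by
    rw [← hn (p * q), hsum]
    refine (norm_add₃_le).trans ?_
    rw [hn, hn, norm_mul, Complex.norm_ofNat]
    nlinarith
  exact le_of_pow_le_pow_left₀ (n := 2) (by norm_num) (by positivity) h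

lemma koranyi_one : koranyi (1 : Heis k) = 0 := by
  simp [koranyi]

lemma koranyi_inv (p : Heis k) : koranyi p⁻¹ = koranyi p := by
  simp [koranyi]

lemma eq_one_of_koranyi_eq_zero {p : Heis k} (h : koranyi p = 0) : p = 1 := by
  have h4 := koranyi_pow_four p
  rw [h] at h4
  have hv : ‖p.v‖ ^ 4 = 0 := by nlinarith [sq_nonneg p.t, pow_nonneg (norm_nonneg p.v) 4]
  have ht : p.t ^ 2 = 0 := by nlinarith [sq_nonneg p.t, pow_nonneg (norm_nonneg p.v) 4]
  ext1
  · simpa using hv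
  · simpa using ht

/-- The Korányi metric `d(p,q) = ‖q⁻¹ · p‖`. -/
noncomputable instance : MetricSpace (Heis k) where
  dist p q := koranyi (q⁻¹ * p)
  dist_self p := by simp [koranyi_one]
  dist_comm p q := by rw [← koranyi_inv]; simp
  dist_triangle p q r := by
    have := koranyi_mul_le (r⁻¹ * q) (q⁻¹ * p)
    rw [mul_assoc, mul_inv_cancel_left] at this
    linarith
  eq_of_dist_eq_zero {p q} h := (inv_mul_eq_one.1 (eq_one_of_koranyi_eq_zero h)).symm

noncomputable instance : MeasurableSpace (Heis k) := borel (Heis k)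

instance : BorelSpace (Heis k) := ⟨rfl⟩

/-- The Hausdorff measure of dimension `2k+1` with respect to the Korányi metric. -/
noncomputable def hausdorff (k : ℕ) : MeasureTheory.Measure (Heis k) :=
  MeasureTheory.Measure.hausdorffMeasure (2 * (k : ℝ) + 1)

/-- A hyperplane is an affine hyperplane of the real vector space `ℝ^{2k} × ℝ`. -/
def IsHyperplane (P : Set (Heis k)) : Prop :=
  ∃ (a : EuclideanSpace ℝ (Fin k ⊕ Fin k)) (b c : ℝ), (a ≠ 0 ∨ b ≠ 0) ∧
    P = {p | inner ℝ a p.v + b * p.t = c}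

/-- The vertical subgroup `𝕎_ν = ν^⊥ × ℝ`. -/
def verticalSubgroup (ν : EuclideanSpace ℝ (Fin k ⊕ Fin k)) : Set (Heis k) :=
  {p | inner ℝ ν p.v = 0}

/-- A vertical hyperplane is a left translate `p' · 𝕎_ν` with `ν` a unit vector of `ℝ^{2k}`. -/
def IsVerticalHyperplane (P : Set (Heis k)) : Prop :=
  ∃ (p' : Heis k) (ν : EuclideanSpace ℝ (Fin k ⊕ Fin k)), ‖ν‖ = 1 ∧
    P = (fun q => p' * q) '' verticalSubgroup ν

/-- Upper Ahlfors-regularity with dimension `2k+1`. -/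
def UpperAhlforsRegular (E : Set (Heis k)) : Prop :=
  ∃ C : ℝ, 0 < C ∧ ∀ (p : Heis k) (r : ℝ), 0 < r →
    hausdorff k (Metric.closedBall p r ∩ E) ≤ ENNReal.ofReal (C * r ^ (2 * k + 1))

/-- Lower Ahlfors-regularity with dimension `2k+1`; the diameter of `E` may be infinite. -/
def LowerAhlforsRegular (E : Set (Heis k)) : Prop :=
  ∃ c : ℝ, 0 < c ∧ ∀ p ∈ E, ∀ r : ℝ, 0 < r → ENNReal.ofReal r < Metric.ediam E →
    ENNReal.ofReal (c * r ^ (2 * k + 1)) ≤ hausdorff k (Metric.closedBall p r ∩ E)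

/-- Ahlfors-regularity with dimension `2k+1`. -/
def AhlforsRegular (E : Set (Heis k)) : Prop :=
  UpperAhlforsRegular E ∧ LowerAhlforsRegular E

/-- The bilateral `β`-number of `E` in the closed ball `B(p,s)`, the infimum running over the
sets `P` in the family `F`. -/
noncomputable def bilateralBeta (F : Set (Heis k) → Prop) (E : Set (Heis k)) (p : Heis k)
    (s : ℝ) : ℝ≥0∞ :=
  ⨅ (P : Set (Heis k)) (_ : F P),
    ((⨆ q ∈ Metric.closedBall p s ∩ E, Metric.infEDist q P / ENNReal.ofReal s) +
      ⨆ q ∈ Metric.closedBall p s ∩ P, Metric.infEDist q E / ENNReal.ofReal s)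

/-- The bilateral weak geometric lemma for the family `F` of hyperplanes:
`∫_0^R ℋ^{2k+1} {q ∈ E ∩ B(p,R) : bβ(q,s) > ε} ds/s ≤ C(ε) R^{2k+1}`. -/
def BWGL (F : Set (Heis k) → Prop) (E : Set (Heis k)) : Prop :=
  ∀ ε : ℝ, 0 < ε → ∃ C : ℝ, 0 < C ∧ ∀ p ∈ E, ∀ R : ℝ, 0 < R →
    (∫⁻ s in Set.Ioo 0 R,
        hausdorff k {q | q ∈ E ∩ Metric.closedBall p R ∧
          ENNReal.ofReal ε < bilateralBeta F E q s} / ENNReal.ofReal s) ≤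
      ENNReal.ofReal (C * R ^ (2 * k + 1))

end Heis

/-!
Vertical hyperplanes are hyperplanes, so `bβ_E ≤ bβ_{v,E}` and one implication is monotonicity
(`Heis.BWGL.mono`). For the converse, let `bβ_E` be very small at `(y, s)`, and let `μ` be small.
If the approximating hyperplane is not vertical, it is a left translate `p · (ℝ^{2k} × {0})` of the
horizontal plane, with a unique centre `p`. At distance much larger than `μ² s` from `p` this plane
looks vertical at the scale `μ² s` (`Heis.horizontalPlane_bilatClose_vertical`), whereas around `p`
it is far from every vertical hyperplane (`Heis.lt_bilateralBeta_of_horizontal`). Call a point bad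
at a scale if `bβ_{v,E} > ε` there. Consequently

* a point that is bad at the scale `μ² s` is bad at the scale `μ s` as well
  (`Heis.lt_bilateralBeta_vertical_scale_up`), and
* the points that are bad at the scale `μ² s` and have distance at most `s / 2` from `y` are all
  within `μ s / 2` of `y`, since they are close to the centre (`Heis.dist_le_of_vertical_bad`).

Iterating over the scales `R μ^j`, `m ≤ j < N`, at which `bβ_E` is small, one sees that the points
bad at the scale `R μ^(N+1)` which lie in a common ball of radius `R μ^m / 2` lie in a ball of radius
`R μ^N / 2` (`Heis.dist_le_of_mem_badSince`). By Ahlfors regularity the measure of the bad points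
is at most `C μ^((2k+1)(N-m))` times the measure of a neighbourhood on which `bβ_E` is large at a
scale comparable to `R μ^m`, where `m` is the first index with the above property, or `m = 0`
(`Heis.mul_measure_le_of_clustered`). The geometric factor makes the sum over `N ≥ m` converge,
and the sum over `m` is controlled by the hypothesis on `bβ_E`
(`Heis.tsum_vertical_le_of_lt_ediam`). Nothing is known on the measurability of the bad sets in
`(q, s)`, so the integrals over `s` are replaced by sums over geometric scales
(`Heis.lintegral_badSet_le`, `Heis.tsum_badSet_le`).
-/

namespace Heis

variable {k : ℕ}

/-! ### Hyperplanes of the Heisenberg group -/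

/-- The rotation `J` of `ℝ^{2k}` that represents the symplectic form: `⟪J w, u⟫ = ω(w, u)`. -/
noncomputable def rot (w : EuclideanSpace ℝ (Fin k ⊕ Fin k)) : EuclideanSpace ℝ (Fin k ⊕ Fin k) :=
  WithLp.toLp 2 (Sum.elim (fun j => -w (Sum.inr j)) (fun j => w (Sum.inl j)))

lemma inner_rot (w u : EuclideanSpace ℝ (Fin k ⊕ Fin k)) : inner ℝ (rot w) u = omega w u := by
  simp only [rot, omega, PiLp.inner_apply, Fintype.sum_sum_type, ← Finset.sum_add_distrib]
  refine Finset.sum_congr rfl fun j _ => ?_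
  simp
  ring

lemma norm_rot (w : EuclideanSpace ℝ (Fin k ⊕ Fin k)) : ‖rot w‖ = ‖w‖ := by
  simp [EuclideanSpace.norm_eq, rot, Fintype.sum_sum_type, add_comm]

lemma rot_rot (w : EuclideanSpace ℝ (Fin k ⊕ Fin k)) : rot (rot w) = -w := by
  ext j
  rcases j with j | j <;> simp [rot]

lemma omega_smul_right (c : ℝ) (v w : EuclideanSpace ℝ (Fin k ⊕ Fin k)) :
    omega v (c • w) = c * omega v w := by
  rw [← inner_rot, ← inner_rot, inner_smul_right]

lemma abs_omega_le (v w : EuclideanSpace ℝ (Fin k ⊕ Fin k)) : |omega v w| ≤ ‖v‖ * ‖w‖ := by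
  rw [← inner_rot, ← norm_rot v]
  exact abs_real_inner_le_norm _ _

lemma dist_eq_koranyi (p q : Heis k) : dist p q = koranyi (q⁻¹ * p) := rfl

lemma norm_v_le_koranyi (p : Heis k) : ‖p.v‖ ≤ koranyi p := by
  refine le_of_pow_le_pow_left₀ (n := 4) (by norm_num) (koranyi_nonneg p) ?_
  rw [koranyi_pow_four]
  nlinarith [sq_nonneg p.t]

lemma abs_t_le_koranyi_sq (p : Heis k) : |p.t| ≤ koranyi p ^ 2 / 4 := by
  refine abs_le_of_sq_le_sq ?_ (by positivity)
  have := koranyi_pow_four p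
  nlinarith [pow_nonneg (norm_nonneg p.v) 4]

lemma koranyi_of_t_eq_zero {p : Heis k} (h : p.t = 0) : koranyi p = ‖p.v‖ := by
  refine (pow_left_inj₀ (koranyi_nonneg p) (norm_nonneg _) four_ne_zero).1 ?_
  rw [koranyi_pow_four, h]
  ring

lemma norm_v_sub_le_dist (p q : Heis k) : ‖p.v - q.v‖ ≤ dist p q := by
  have := norm_v_le_koranyi (q⁻¹ * p)
  rwa [mul_v, inv_v, neg_add_eq_sub] at this

/-- Right translation by a horizontal vector of length `|a|` moves every point by `|a|`. -/
lemma dist_mul_horizontal (x : Heis k) (a : ℝ) {ν : EuclideanSpace ℝ (Fin k ⊕ Fin k)}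
    (hν : ‖ν‖ = 1) : dist (x * ⟨a • ν, 0⟩) x = |a| := by
  rw [dist_eq_koranyi, inv_mul_cancel_left, koranyi_of_t_eq_zero rfl, norm_smul, hν, mul_one,
    Real.norm_eq_abs]

/-- The non-vertical hyperplane `p · (ℝ^{2k} × {0})`, spanned by the horizontal directions at `p`,
which is called its centre. -/
def horizontalPlane (p : Heis k) : Set (Heis k) := {q | (p⁻¹ * q).t = 0}

lemma isVerticalHyperplane_iff {P : Set (Heis k)} :
    IsVerticalHyperplane P ↔ ∃ (ν : EuclideanSpace ℝ (Fin k ⊕ Fin k)) (c : ℝ), ‖ν‖ = 1 ∧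
      P = {p | inner ℝ ν p.v = c} := by
  have key : ∀ (p' : Heis k) (ν : EuclideanSpace ℝ (Fin k ⊕ Fin k)),
      (fun q => p' * q) '' verticalSubgroup ν = {p | inner ℝ ν p.v = inner ℝ ν p'.v} := by
    intro p' ν
    ext p
    constructor
    · rintro ⟨q, hq, rfl⟩
      have hq' : inner ℝ ν q.v = 0 := hq
      simp [inner_add_right, hq']
    · intro hp
      have hp' : inner ℝ ν p.v = inner ℝ ν p'.v := hp
      refine ⟨p'⁻¹ * p, ?_, by simp⟩
      simp [verticalSubgroup, inner_add_right, inner_neg_right, hp']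
  constructor
  · rintro ⟨p', ν, hν, rfl⟩
    exact ⟨ν, _, hν, key p' ν⟩
  · rintro ⟨ν, c, hν, rfl⟩
    refine ⟨⟨c • ν, 0⟩, ν, hν, ?_⟩
    rw [key]
    simp [inner_smul_right, hν]

lemma IsVerticalHyperplane.isHyperplane {P : Set (Heis k)} (h : IsVerticalHyperplane P) :
    IsHyperplane P := by
  obtain ⟨ν, c, hν, rfl⟩ := isVerticalHyperplane_iff.1 h
  refine ⟨ν, 0, c, Or.inl ?_, by simp⟩
  rintro rfl
  simp at hν

lemma IsHyperplane.vertical_or_horizontal {P : Set (Heis k)} (h : IsHyperplane P) :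
    IsVerticalHyperplane P ∨ ∃ p, P = horizontalPlane p := by
  obtain ⟨a, b, c, hab, rfl⟩ := h
  by_cases hb : b = 0
  · left
    have ha : a ≠ 0 := by simpa [hb] using hab
    have ha' : ‖a‖ ≠ 0 := norm_ne_zero_iff.2 ha
    refine isVerticalHyperplane_iff.2 ⟨‖a‖⁻¹ • a, ‖a‖⁻¹ * c, by simp [norm_smul, ha'], ?_⟩
    ext p
    simp [hb, inner_smul_left, ha']
  · right
    refine ⟨⟨rot ((2 / b) • a), c / b⟩, ?_⟩
    ext p
    have h1 : omega (rot ((2 / b) • a)) p.v = -(2 / b) * inner ℝ a p.v := by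
      rw [← inner_rot, rot_rot, inner_neg_left, inner_smul_left]
      simp
    simp only [horizontalPlane, Set.mem_ofPred_eq, mul_t, inv_t, inv_v, omega_neg_left, h1]
    constructor
    · intro h
      rw [← h]
      field_simp
      ring
    · intro h
      field_simp at h
      linarith

/-! ### Bilateral approximation -/

/-- `E` and `P` approximate each other within distance `η` in the closed ball `B(y, s)`. -/
def BilatClose (E P : Set (Heis k)) (y : Heis k) (s η : ℝ) : Prop :=
  (∀ q ∈ E, dist q y ≤ s → ∃ x ∈ P, dist q x ≤ η) ∧
    ∀ x ∈ P, dist x y ≤ s → ∃ q ∈ E, dist x q ≤ η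

lemma BilatClose.trans {E P V : Set (Heis k)} {y z : Heis k} {s s' ρ η η' : ℝ}
    (h : BilatClose E P y s η) (h' : BilatClose P V z s' η') (h1 : dist z y + ρ + η' ≤ s)
    (h2 : ρ + η ≤ s') (hη : 0 ≤ η) (hη' : 0 ≤ η') : BilatClose E V z ρ (η + η') := by
  constructor
  · intro e he hez
    obtain ⟨x, hx, hex⟩ := h.1 e he (by linarith [dist_triangle e z y])
    obtain ⟨v, hv, hxv⟩ := h'.1 x hx (by linarith [dist_triangle_left x z e])
    exact ⟨v, hv, by linarith [dist_triangle e x v]⟩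
  · intro v hv hvz
    obtain ⟨x, hx, hvx⟩ := h'.2 v hv (by linarith)
    obtain ⟨e, he, hxe⟩ := h.2 x hx (by linarith [dist_triangle_left x z v, dist_triangle x z y])
    exact ⟨e, he, by linarith [dist_triangle v x e]⟩

lemma exists_dist_le_of_infEDist_div_lt {A : Set (Heis k)} {q : Heis k} {s δ : ℝ} (hs : 0 < s)
    (h : Metric.infEDist q A / ENNReal.ofReal s < ENNReal.ofReal δ) :
    ∃ x ∈ A, dist q x ≤ δ * s := by
  have hδ : 0 < δ := ENNReal.ofReal_pos.1 (pos_of_gt h)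
  rw [ENNReal.div_lt_iff (Or.inl (by simpa using hs)) (Or.inl ENNReal.ofReal_ne_top),
    ← ENNReal.ofReal_mul hδ.le] at h
  obtain ⟨x, hx, hqx⟩ := Metric.infEDist_lt_iff.1 h
  rw [edist_dist] at hqx
  exact ⟨x, hx, (ENNReal.ofReal_le_ofReal_iff (by positivity)).1 hqx.le⟩

lemma exists_bilatClose_of_bilateralBeta_lt {F : Set (Heis k) → Prop} {E : Set (Heis k)}
    {y : Heis k} {s δ : ℝ} (hs : 0 < s) (h : bilateralBeta F E y s < ENNReal.ofReal δ) :
    ∃ P, F P ∧ BilatClose E P y s (δ * s) := by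
  simp only [bilateralBeta, iInf_lt_iff] at h
  obtain ⟨P, hP, h⟩ := h
  refine ⟨P, hP, fun q hq hqy => ?_, fun q hq hqy => ?_⟩
  · refine exists_dist_le_of_infEDist_div_lt hs (lt_of_le_of_lt ?_ h)
    exact (le_iSup₂ (f := fun q (_ : q ∈ Metric.closedBall y s ∩ E) =>
      Metric.infEDist q P / ENNReal.ofReal s) q ⟨hqy, hq⟩).trans le_self_add
  · refine exists_dist_le_of_infEDist_div_lt hs (lt_of_le_of_lt ?_ h)
    exact (le_iSup₂ (f := fun q (_ : q ∈ Metric.closedBall y s ∩ P) =>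
      Metric.infEDist q E / ENNReal.ofReal s) q ⟨hqy, hq⟩).trans le_add_self

lemma bilateralBeta_le_of_bilatClose {F : Set (Heis k) → Prop} {E P : Set (Heis k)}
    {y : Heis k} {s η : ℝ} (hs : 0 < s) (hη : 0 ≤ η) (hP : F P) (h : BilatClose E P y s η) :
    bilateralBeta F E y s ≤ ENNReal.ofReal (2 * η / s) := by
  have key : ∀ (q : Heis k) (A : Set (Heis k)), (∃ x ∈ A, dist q x ≤ η) →
      Metric.infEDist q A / ENNReal.ofReal s ≤ ENNReal.ofReal (η / s) := by
    rintro q A ⟨x, hx, hqx⟩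
    rw [ENNReal.ofReal_div_of_pos hs]
    gcongr
    refine (Metric.infEDist_le_edist_of_mem hx).trans ?_
    rw [edist_dist]
    exact ENNReal.ofReal_le_ofReal hqx
  refine (iInf₂_le P hP).trans ?_
  have h2 : 2 * η / s = η / s + η / s := by ring
  rw [h2, ENNReal.ofReal_add (by positivity) (by positivity)]
  exact add_le_add (iSup₂_le fun q hq => key q P (h.1 q hq.2 hq.1))
    (iSup₂_le fun q hq => key q E (h.2 q hq.2 hq.1))

/-- Passing to a smaller ball increases `bβ` at most by the ratio of the radii. -/
lemma bilateralBeta_le_mul {F : Set (Heis k) → Prop} {E : Set (Heis k)} {y z : Heis k}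
    {s s' : ℝ} (hs : 0 < s) (hs' : 0 < s') (h : dist z y + s ≤ s') :
    bilateralBeta F E z s ≤ ENNReal.ofReal (s' / s) * bilateralBeta F E y s' := by
  have hsub : Metric.closedBall z s ⊆ Metric.closedBall y s' :=
    Metric.closedBall_subset_closedBall' (by linarith)
  have hdiv : ∀ a : ℝ≥0∞,
      a / ENNReal.ofReal s = ENNReal.ofReal (s' / s) * (a / ENNReal.ofReal s') := by
    intro a
    rw [ENNReal.ofReal_div_of_pos hs, div_eq_mul_inv, div_eq_mul_inv, div_eq_mul_inv]
    have h1 : ENNReal.ofReal s' * (ENNReal.ofReal s')⁻¹ = 1 :=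
      ENNReal.mul_inv_cancel (by simpa using hs') ENNReal.ofReal_ne_top
    calc a * (ENNReal.ofReal s)⁻¹
        = a * (ENNReal.ofReal s)⁻¹ * (ENNReal.ofReal s' * (ENNReal.ofReal s')⁻¹) := by
          rw [h1, mul_one]
      _ = _ := by ring
  have hpos : ENNReal.ofReal (s' / s) ≠ 0 := by
    have : 0 < s' / s := by positivity
    simpa using this
  rw [bilateralBeta, bilateralBeta]
  simp only [ENNReal.mul_iInf_of_ne hpos ENNReal.ofReal_ne_top]
  refine iInf₂_mono fun P _ => ?_
  simp only [hdiv, mul_add, ENNReal.mul_iSup]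
  exact add_le_add (biSup_mono fun q hq => ⟨hsub hq.1, hq.2⟩)
    (biSup_mono fun q hq => ⟨hsub hq.1, hq.2⟩)

/-! ### Horizontal planes at a small scale -/

/-- Within distance `r` of one of its points `q` at distance `L ≥ 2r` from the centre `p`, a
horizontal plane is `r² / L`-close to a vertical hyperplane. In coordinates centred at `q` the
plane is `{τ = -⟪J w, u⟫ / 2}` with `w = q.v - p.v` and `‖w‖ = L`, and the vertical hyperplane is
`{⟪J w, u⟫ = 0}`. Points are moved from one to the other in the horizontal direction `J w / L`. -/
lemma horizontalPlane_bilatClose_vertical {p q : Heis k} (hq : q ∈ horizontalPlane p) {r : ℝ}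
    (hr : 0 < r) (hL : 2 * r ≤ dist q p) :
    ∃ V, IsVerticalHyperplane V ∧
      BilatClose (horizontalPlane p) V q r (r ^ 2 / dist q p) := by
  set L := dist q p with hLdef
  have hL0 : 0 < L := by linarith
  set w := q.v - p.v with hw
  have hq0 : (p⁻¹ * q).t = 0 := hq
  have hwL : ‖w‖ = L := by
    rw [hLdef, dist_eq_koranyi, koranyi_of_t_eq_zero hq0, mul_v, inv_v, neg_add_eq_sub]
  set ν := L⁻¹ • rot w with hνdef
  have hν : ‖ν‖ = 1 := by
    rw [hνdef, norm_smul, norm_rot, hwL, Real.norm_eq_abs, abs_of_pos (inv_pos.2 hL0),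
      inv_mul_cancel₀ hL0.ne']
  have hων : ∀ u, omega w u = L * inner ℝ ν u := by
    intro u
    rw [hνdef, real_inner_smul_left, inner_rot, mul_inv_cancel_left₀ hL0.ne']
  have hνν : inner ℝ ν ν = (1 : ℝ) := by rw [real_inner_self_eq_norm_sq, hν]; norm_num
  have hpx : ∀ x : Heis k,
      (p⁻¹ * x).t = (q⁻¹ * x).t + L * inner ℝ ν (x.v - q.v) / 2 := by
    intro x
    have h1 : p⁻¹ * x = (p⁻¹ * q) * (q⁻¹ * x) := by group
    have h2 : (p⁻¹ * q).v = w := by rw [mul_v, inv_v, neg_add_eq_sub]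
    have h3 : (q⁻¹ * x).v = x.v - q.v := by rw [mul_v, inv_v, neg_add_eq_sub]
    rw [h1, mul_t, hq0, h2, h3, hων]
    ring
  have htau : ∀ x : Heis k, dist x q ≤ r → |(q⁻¹ * x).t| ≤ r ^ 2 / 4 := by
    intro x hx
    refine (abs_t_le_koranyi_sq _).trans ?_
    have : koranyi (q⁻¹ * x) ≤ r := hx
    have := koranyi_nonneg (q⁻¹ * x)
    gcongr
  refine ⟨{x | inner ℝ ν x.v = inner ℝ ν q.v}, isVerticalHyperplane_iff.2 ⟨ν, _, hν, rfl⟩, ?_, ?_⟩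
  · intro x hx hxq
    have hx0 : (p⁻¹ * x).t = 0 := hx
    rw [hpx] at hx0
    refine ⟨x * ⟨(-inner ℝ ν (x.v - q.v)) • ν, 0⟩, ?_, ?_⟩
    · simp only [Set.mem_ofPred_eq, mul_v, inner_add_right, inner_smul_right, hνν, inner_sub_right]
      ring
    · rw [dist_comm, dist_mul_horizontal _ _ hν, abs_neg, le_div_iff₀ hL0]
      have h1 : L * inner ℝ ν (x.v - q.v) = -2 * (q⁻¹ * x).t := by linarith
      have h2 := congrArg abs h1
      rw [abs_mul, abs_mul, abs_of_pos hL0, abs_neg, abs_two] at h2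
      linarith [htau x hxq, sq_nonneg r]
  · intro x hx hxq
    have hx0 : inner ℝ ν (x.v - q.v) = (0 : ℝ) := by
      rw [inner_sub_right, sub_eq_zero]
      exact hx
    have ho : |omega (x.v - q.v) ν| ≤ L / 2 := by
      refine (abs_omega_le _ _).trans ?_
      rw [hν, mul_one]
      linarith [norm_v_sub_le_dist x q]
    set o := omega (x.v - q.v) ν with hodef
    have hden : L / 2 ≤ L + o := by linarith [(abs_le.1 ho).1]
    have hden0 : 0 < L + o := by linarith
    set a := -2 * (q⁻¹ * x).t / (L + o) with ha
    refine ⟨x * ⟨a • ν, 0⟩, ?_, ?_⟩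
    · have h1 : (p⁻¹ * (x * ⟨a • ν, 0⟩)).t = (p⁻¹ * x).t + a * (L + o) / 2 := by
        have h2 : (p⁻¹ * x).v = w + (x.v - q.v) := by
          rw [mul_v, inv_v, hw]
          abel
        rw [← mul_assoc, mul_t, h2, omega_smul_right, omega_add_left, hων, hνν]
        simp only [hodef]
        ring
      change (p⁻¹ * (x * ⟨a • ν, 0⟩)).t = 0
      rw [h1, hpx, hx0, ha, div_mul_cancel₀ _ hden0.ne']
      ring
    · rw [dist_comm, dist_mul_horizontal _ _ hν, ha, abs_div, abs_of_pos hden0, abs_mul]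
      have := htau x hxq
      norm_num
      rw [div_le_div_iff₀ hden0 hL0]
      have h4 : 2 * |(q⁻¹ * x).t| * L ≤ 2 * (r ^ 2 / 4) * L := by gcongr
      have h5 : r ^ 2 * (L / 2) ≤ r ^ 2 * (L + o) := by gcongr
      simp only [mul_t, inv_t, inv_v] at h4
      linarith

/-- A set close to a horizontal plane is well approximated by vertical hyperplanes at the scale
`μ² s` around each point at distance at least `μ s / 4` from the centre of the plane. -/
lemma dist_centre_le {E : Set (Heis k)} {p y z : Heis k} {ε μ s η : ℝ} (hε : 0 < ε)
    (hε1 : ε ≤ 1) (hμ : 0 < μ) (hμε : 1000 * μ ≤ ε) (hs : 0 < s) (hη0 : 0 ≤ η)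
    (hη : η ≤ ε * (μ ^ 2 * s) / 8) (h : BilatClose E (horizontalPlane p) y s η) (hz : z ∈ E)
    (hzy : dist z y ≤ s / 2)
    (hbad : ENNReal.ofReal ε < bilateralBeta IsVerticalHyperplane E z (μ ^ 2 * s)) :
    dist z p ≤ μ * s / 4 := by
  by_contra! hzp
  set ρ := μ ^ 2 * s with hρ
  have hρ0 : 0 < ρ := by positivity
  have hμs : 0 < μ * s := by positivity
  have hρμ : ρ = μ * (μ * s) := by rw [hρ]; ring
  have hμ1 : μ ≤ 1 / 1000 := by linarith
  have hρ1 : ρ ≤ μ * s / 1000 := by rw [hρμ]; nlinarith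
  have hμs1 : μ * s ≤ s / 1000 := by nlinarith
  have hηρ : η ≤ ρ / 8 := by nlinarith
  obtain ⟨q, hq, hzq⟩ := h.1 z hz (by linarith)
  have hL : μ * s / 8 ≤ dist q p := by linarith [dist_triangle z q p]
  obtain ⟨V, hV, hclose⟩ := horizontalPlane_bilatClose_vertical hq (r := 3 * ρ) (by positivity)
    (by linarith)
  have hη' : (3 * ρ) ^ 2 / dist q p ≤ ε * ρ / 8 := by
    rw [div_le_iff₀ (by linarith)]
    calc (3 * ρ) ^ 2 = 9 * ρ * μ * (μ * s) := by rw [hρμ]; ring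
      _ = (9 * 8 * 8 * μ) * ρ / 8 * (μ * s / 8) := by ring
      _ ≤ ε * ρ / 8 * dist q p := by gcongr; linarith
  have hclose2 : BilatClose (horizontalPlane p) V z (2 * ρ) (ε * ρ / 8) := by
    refine ⟨fun x hx hxz => ?_, fun x hx hxz => ?_⟩
    · obtain ⟨v, hv, hxv⟩ := hclose.1 x hx (by linarith [dist_triangle x z q])
      exact ⟨v, hv, hxv.trans hη'⟩
    · obtain ⟨v, hv, hxv⟩ := hclose.2 x hx (by linarith [dist_triangle x z q])
      exact ⟨v, hv, hxv.trans hη'⟩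
  have hερ : ε * ρ ≤ ρ := by nlinarith
  have := bilateralBeta_le_of_bilatClose hρ0 (by positivity) hV
    (h.trans hclose2 (by linarith) (by linarith) hη0 (by positivity))
  refine absurd (hbad.trans_le this) (not_lt.2 (ENNReal.ofReal_le_ofReal ?_))
  rw [div_le_iff₀ hρ0]
  linarith

/-- Near its centre a horizontal plane is far from all vertical hyperplanes: it contains two
points at distance `σ / 4` from the centre, in the directions `± ν`. -/
lemma lt_bilateralBeta_of_horizontal {E : Set (Heis k)} {p y : Heis k} {ε σ s η : ℝ}
    (hε : 0 < ε) (hε1 : ε ≤ 1 / 16) (hσ : 0 < σ) (hσs : σ ≤ s) (hη : η ≤ σ / 16)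
    (h : BilatClose E (horizontalPlane p) y s η) (hyp : dist y p ≤ σ / 4) :
    ENNReal.ofReal ε < bilateralBeta IsVerticalHyperplane E y σ := by
  by_contra! hle
  obtain ⟨V, hV, hEV⟩ := exists_bilatClose_of_bilateralBeta_lt (δ := 2 * ε) hσ
    (hle.trans_lt ((ENNReal.ofReal_lt_ofReal_iff (by linarith)).2 (by linarith)))
  obtain ⟨ν, c, hν, rfl⟩ := isVerticalHyperplane_iff.1 hV
  have hνν : inner ℝ ν ν = (1 : ℝ) := by rw [real_inner_self_eq_norm_sq, hν]; norm_num
  have key : ∀ a : ℝ, |a| = σ / 4 → |inner ℝ ν p.v + a - c| ≤ σ / 16 + 2 * ε * σ := by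
    intro a ha
    have hxp := dist_mul_horizontal p a hν
    set x : Heis k := p * ⟨a • ν, 0⟩ with hx
    have hxP : x ∈ horizontalPlane p := by
      simp [horizontalPlane, hx, -mul_t]
    have hxy : dist x y ≤ σ / 2 := by linarith [dist_triangle_right x y p]
    obtain ⟨e, he, hxe⟩ := h.2 x hxP (by linarith)
    obtain ⟨v, hv, hev⟩ := hEV.1 e he (by linarith [dist_triangle_left e y x])
    have hv' : inner ℝ ν v.v = c := hv
    have h1 : inner ℝ ν (x.v - v.v) = inner ℝ ν p.v + a - c := by
      rw [inner_sub_right, hv', hx, mul_v, inner_add_right, inner_smul_right, hνν, mul_one]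
    rw [← h1]
    refine (abs_real_inner_le_norm _ _).trans ?_
    rw [hν, one_mul]
    linarith [norm_v_sub_le_dist x v, dist_triangle x e v]
  have h1 := abs_le.1 (key (σ / 4) (abs_of_pos (by positivity)))
  have h2 := abs_le.1 (key (-(σ / 4)) (by rw [abs_neg, abs_of_pos (by positivity)]))
  nlinarith

/-- If `bβ_E(y, s)` is small and no vertical hyperplane approximates `E` well around `y` at the
scale `μ² s`, then `E` is close in `B(y, s)` to a horizontal plane with centre near `y`. -/
lemma exists_centre {E : Set (Heis k)} {y : Heis k} {ε μ s : ℝ} (hε : 0 < ε)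
    (hε1 : ε ≤ 1) (hμ : 0 < μ) (hμε : 1000 * μ ≤ ε) (hs : 0 < s)
    (hgood : bilateralBeta IsHyperplane E y s ≤ ENNReal.ofReal (ε * μ ^ 2 / 16))
    (hbad : ENNReal.ofReal ε < bilateralBeta IsVerticalHyperplane E y (μ ^ 2 * s)) :
    ∃ p, BilatClose E (horizontalPlane p) y s (ε * (μ ^ 2 * s) / 8) := by
  have hδ : 0 < ε * μ ^ 2 / 16 := by positivity
  obtain ⟨P, hP, hclose⟩ := exists_bilatClose_of_bilateralBeta_lt (δ := 2 * (ε * μ ^ 2 / 16)) hs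
    (hgood.trans_lt ((ENNReal.ofReal_lt_ofReal_iff (by linarith)).2 (by linarith)))
  have heq : 2 * (ε * μ ^ 2 / 16) * s = ε * (μ ^ 2 * s) / 8 := by ring
  rw [heq] at hclose
  rcases hP.vertical_or_horizontal with hV | ⟨p, rfl⟩
  · exfalso
    have hρ : 0 < μ ^ 2 * s := by positivity
    have hμ1 : μ ^ 2 * s ≤ s := by
      have : μ ^ 2 ≤ 1 := pow_le_one₀ hμ.le (by linarith)
      nlinarith
    have hclose2 : BilatClose E P y (μ ^ 2 * s) (ε * (μ ^ 2 * s) / 8) :=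
      ⟨fun q hq hqy => hclose.1 q hq (hqy.trans hμ1), fun q hq hqy => hclose.2 q hq (hqy.trans hμ1)⟩
    have := bilateralBeta_le_of_bilatClose hρ (by positivity) hV hclose2
    refine absurd (hbad.trans_le this) (not_lt.2 (ENNReal.ofReal_le_ofReal ?_))
    rw [div_le_iff₀ hρ]
    nlinarith
  · exact ⟨p, hclose⟩

/-- Bad approximation by vertical hyperplanes passes from the scale `μ² s` up to the scale `μ s`
where `bβ_E(y, s)` is small. -/
lemma lt_bilateralBeta_vertical_scale_up {E : Set (Heis k)} {y : Heis k} {ε μ s : ℝ} (hε : 0 < ε)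
    (hε1 : ε ≤ 1 / 16) (hμ : 0 < μ) (hμε : 1000 * μ ≤ ε) (hs : 0 < s) (hy : y ∈ E)
    (hgood : bilateralBeta IsHyperplane E y s ≤ ENNReal.ofReal (ε * μ ^ 2 / 16))
    (hbad : ENNReal.ofReal ε < bilateralBeta IsVerticalHyperplane E y (μ ^ 2 * s)) :
    ENNReal.ofReal ε < bilateralBeta IsVerticalHyperplane E y (μ * s) := by
  obtain ⟨p, hp⟩ := exists_centre hε (by linarith) hμ hμε hs hgood hbad
  have hd := dist_centre_le hε (by linarith) hμ hμε hs (by positivity) le_rfl hp hy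
    (by rw [dist_self]; positivity) hbad
  have hμs : 0 < μ * s := by positivity
  refine lt_bilateralBeta_of_horizontal hε hε1 hμs (by nlinarith) ?_ hp hd
  have h1 : ε * μ ≤ 1 / 16 := by nlinarith
  nlinarith

/-- The points of `B(y, s/2)` around which vertical hyperplanes approximate `E` badly at the scale
`μ² s` cluster around a single point, the centre. -/
lemma dist_le_of_vertical_bad {E : Set (Heis k)} {y z : Heis k} {ε μ s : ℝ} (hε : 0 < ε)
    (hε1 : ε ≤ 1) (hμ : 0 < μ) (hμε : 1000 * μ ≤ ε) (hs : 0 < s) (hy : y ∈ E) (hz : z ∈ E)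
    (hzy : dist z y ≤ s / 2)
    (hgood : bilateralBeta IsHyperplane E y s ≤ ENNReal.ofReal (ε * μ ^ 2 / 16))
    (hbad : ENNReal.ofReal ε < bilateralBeta IsVerticalHyperplane E y (μ ^ 2 * s))
    (hbadz : ENNReal.ofReal ε < bilateralBeta IsVerticalHyperplane E z (μ ^ 2 * s)) :
    dist z y ≤ μ * s / 2 := by
  obtain ⟨p, hp⟩ := exists_centre hε hε1 hμ hμε hs hgood hbad
  have hd := dist_centre_le hε hε1 hμ hμε hs (by positivity) le_rfl hp hy
    (by rw [dist_self]; positivity) hbad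
  have hd' := dist_centre_le hε hε1 hμ hμε hs (by positivity) le_rfl hp hz hzy hbadz
  linarith [dist_triangle_right z y p]

open MeasureTheory Metric

/-! ### Covering and summation -/

/-- The Cauchy product formula for series in `ℝ≥0∞`, where multiplication is not continuous. -/
lemma _root_.ENNReal.tsum_mul_tsum_eq_tsum_sum_antidiagonal (f g : ℕ → ℝ≥0∞) :
    (∑' n, f n) * ∑' n, g n =
      ∑' n, ∑ x ∈ Finset.HasAntidiagonal.antidiagonal n, f x.1 * g x.2 := by
  rw [← ENNReal.tsum_mul_right]
  simp_rw [← ENNReal.tsum_mul_left]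
  rw [← ENNReal.tsum_prod, ← (Finset.HasAntidiagonal.sigmaAntidiagonalEquivProd (A := ℕ)).tsum_eq,
    ENNReal.tsum_sigma']
  refine tsum_congr fun n => ?_
  rw [tsum_fintype]
  exact Finset.sum_coe_sort (Finset.HasAntidiagonal.antidiagonal n) (fun x => f x.1 * g x.2)

/-- If points of `F` at distance at most `5 δ` are at distance at most `τ`, then a maximal
disjoint family of balls of radius `δ` centred on `F` yields a cover of `F` by balls of radius `τ`,
so that `F` is much smaller than the part `G` of `E` around it. -/
lemma mul_measure_le_of_clustered {X : Type*} [PseudoMetricSpace X] [MeasurableSpace X]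
    [OpensMeasurableSpace X] (ν : Measure X) {E F G : Set X} {δ τ : ℝ} {a b : ℝ≥0∞}
    (hE : MeasurableSet E) (hFE : F ⊆ E) (hδ : 0 ≤ δ)
    (hcl : ∀ x ∈ F, ∀ y ∈ F, dist x y ≤ 5 * δ → dist x y ≤ τ)
    (ha : a ≠ 0) (hlow : ∀ x ∈ F, a ≤ ν (closedBall x δ ∩ E))
    (hup : ∀ x ∈ F, ν (closedBall x τ ∩ E) ≤ b)
    (hG : ∀ x ∈ F, closedBall x δ ∩ E ⊆ G) (hGtop : ν G ≠ ∞) :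
    a * ν F ≤ b * ν G := by
  obtain ⟨u, huF, hdisj, hcov⟩ := Vitali.exists_disjoint_subfamily_covering_enlargement_closedBall
    F id (fun _ => δ) δ (fun _ _ => le_rfl) 5 (by norm_num)
  set B : u → Set X := fun i => closedBall (i : X) δ ∩ E with hB
  have hBm : ∀ i, MeasurableSet (B i) := fun i => measurableSet_closedBall.inter hE
  have hBd : Pairwise (Function.onFun Disjoint B) := fun i j hij =>
    (hdisj i.2 j.2 (fun h => hij (Subtype.ext h))).mono Set.inter_subset_left Set.inter_subset_left
  have hBG : (⋃ i, B i) ⊆ G := Set.iUnion_subset fun i => hG i (huF i.2)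
  have hBtop : ν (⋃ i, B i) ≠ ∞ := ne_top_of_le_ne_top hGtop (measure_mono hBG)
  have hfin := Measure.finite_const_le_meas_of_disjoint_iUnion ν (pos_iff_ne_zero.2 ha) hBm hBd
    hBtop
  have huniv : {i : u | a ≤ ν (B i)} = Set.univ :=
    Set.eq_univ_of_forall fun i => hlow i (huF i.2)
  rw [huniv, Set.finite_univ_iff] at hfin
  have hsub : F ⊆ ⋃ i : u, closedBall (i : X) τ ∩ E := by
    intro x hx
    obtain ⟨y, hy, hxy⟩ := hcov x hx
    have h5 : dist x y ≤ 5 * δ := hxy (mem_closedBall_self hδ)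
    exact Set.mem_iUnion.2 ⟨⟨y, hy⟩, hcl x hx y (huF hy) h5, hFE hx⟩
  calc a * ν F ≤ a * ∑' _ : u, b := by
        gcongr
        exact (measure_mono hsub).trans ((measure_iUnion_le _).trans
          (ENNReal.tsum_le_tsum fun i => hup i (huF i.2)))
    _ = b * ∑' _ : u, a := by
        rw [← ENNReal.tsum_mul_left, ← ENNReal.tsum_mul_left]
        simp_rw [mul_comm]
    _ ≤ b * ν G := by
        gcongr
        exact (ENNReal.tsum_le_tsum fun i : u => hlow i (huF i.2)).trans
          ((tsum_meas_le_meas_iUnion_of_disjoint ν hBm hBd).trans (measure_mono hBG))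

lemma tsum_ofReal_geometric_le {a c μ : ℝ} (hc : 0 ≤ c) (ha : 0 ≤ a) (hμ : 0 ≤ μ)
    (hμ2 : μ ≤ 1 / 2) (d : ℕ) (hd : d ≠ 0) :
    ∑' n, ENNReal.ofReal (c * (a * μ ^ n) ^ d) ≤ ENNReal.ofReal (2 * c * a ^ d) := by
  have hθ0 : 0 ≤ μ ^ d := by positivity
  have hθ : μ ^ d ≤ 1 / 2 := (pow_le_of_le_one hμ (by linarith) hd).trans hμ2
  have hsum := (hasSum_geometric_of_lt_one hθ0 (by linarith)).mul_left (c * a ^ d)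
  have heq : ∀ n : ℕ, c * (a * μ ^ n) ^ d = c * a ^ d * (μ ^ d) ^ n := by
    intro n
    rw [mul_pow, ← pow_mul, ← pow_mul, mul_comm n d, mul_assoc]
  simp_rw [heq]
  rw [← ENNReal.ofReal_tsum_of_nonneg (fun n => by positivity) hsum.summable, hsum.tsum_eq]
  refine ENNReal.ofReal_le_ofReal ?_
  have h2 : (1 - μ ^ d)⁻¹ ≤ 2 := by
    rw [inv_le_comm₀ (by linarith) (by norm_num)]
    linarith
  nlinarith [mul_nonneg hc (pow_nonneg ha d)]

/-! ### Bad sets at geometric scales -/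

/-- The points of `E ∩ B(p, R)` at which `bβ` exceeds `ε` at the scale `s`. -/
def badSet (F : Set (Heis k) → Prop) (E : Set (Heis k)) (ε : ℝ) (p : Heis k) (R s : ℝ) :
    Set (Heis k) :=
  {q | q ∈ E ∩ closedBall p R ∧ ENNReal.ofReal ε < bilateralBeta F E q s}

lemma bilateralBeta_anti {F F' : Set (Heis k) → Prop} (h : ∀ P, F P → F' P) (E : Set (Heis k))
    (q : Heis k) (s : ℝ) : bilateralBeta F' E q s ≤ bilateralBeta F E q s :=
  le_iInf₂ fun P hP => iInf₂_le P (h P hP)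

/-- If `bβ > ε` at `(z, s)`, then `bβ > μ ε` at `(y, s')` for every larger ball `B(y, s')` with
`s' ≤ s / μ`. -/
lemma lt_bilateralBeta_of_scale {F : Set (Heis k) → Prop} {E : Set (Heis k)} {y z : Heis k}
    {s s' ε μ : ℝ} (hs : 0 < s) (hμ : 0 < μ) (h : dist z y + s ≤ s') (hs' : s' * μ ≤ s)
    (hbad : ENNReal.ofReal ε < bilateralBeta F E z s) :
    ENNReal.ofReal (μ * ε) < bilateralBeta F E y s' := by
  have hs'0 : 0 < s' := by linarith [dist_nonneg (x := z) (y := y)]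
  have h1 : s' / s ≤ μ⁻¹ := by
    rw [div_le_iff₀ hs, ← div_eq_inv_mul, le_div_iff₀ hμ]
    exact hs'
  by_contra! hle
  refine absurd hbad (not_lt.2 ?_)
  calc bilateralBeta F E z s ≤ ENNReal.ofReal (s' / s) * bilateralBeta F E y s' :=
        bilateralBeta_le_mul hs hs'0 h
    _ ≤ ENNReal.ofReal μ⁻¹ * ENNReal.ofReal (μ * ε) := by gcongr
    _ = ENNReal.ofReal ε := by
        rw [← ENNReal.ofReal_mul (by positivity), inv_mul_cancel_left₀ hμ.ne']

lemma badSet_subset {F : Set (Heis k) → Prop} {E : Set (Heis k)} {p : Heis k}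
    {R R' s s' ε μ : ℝ} (hs : 0 < s) (hμ : 0 < μ) (hR : R ≤ R') (h : s ≤ s') (hs' : s' * μ ≤ s) :
    badSet F E ε p R s ⊆ badSet F E (μ * ε) p R' s' :=
  fun q hq => ⟨⟨hq.1.1, closedBall_subset_closedBall hR hq.1.2⟩,
    lt_bilateralBeta_of_scale hs hμ (by rwa [dist_self, zero_add]) hs' hq.2⟩

/-- The Carleson integral is bounded by the sum over the scales `R μⁿ`. -/
lemma lintegral_badSet_le {F : Set (Heis k) → Prop} {E : Set (Heis k)} {p : Heis k} {R ε μ : ℝ}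
    (hR : 0 < R) (hμ : 0 < μ) (hμ1 : μ < 1) :
    ∫⁻ s in Set.Ioo 0 R, hausdorff k (badSet F E ε p R s) / ENNReal.ofReal s ≤
      ENNReal.ofReal μ⁻¹ * ∑' n : ℕ, hausdorff k (badSet F E (μ * ε) p R (R * μ ^ n)) := by
  have hsub : Set.Ioo 0 R ⊆ ⋃ n : ℕ, Set.Ioc (R * μ ^ (n + 1)) (R * μ ^ n) := by
    intro s hs
    obtain ⟨n, hn1, hn2⟩ := exists_nat_pow_near_of_lt_one (x := s / R) (div_pos hs.1 hR)
      ((div_le_one hR).2 hs.2.le) hμ hμ1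
    rw [lt_div_iff₀' hR] at hn1
    rw [div_le_iff₀' hR] at hn2
    exact Set.mem_iUnion.2 ⟨n, hn1, hn2⟩
  refine (lintegral_mono_set hsub).trans ((lintegral_iUnion_le _ _).trans ?_)
  rw [← ENNReal.tsum_mul_left]
  refine ENNReal.tsum_le_tsum fun n => ?_
  have hσ : 0 < R * μ ^ (n + 1) := by positivity
  set H := hausdorff k (badSet F E (μ * ε) p R (R * μ ^ n)) with hH
  calc ∫⁻ s in Set.Ioc (R * μ ^ (n + 1)) (R * μ ^ n),
        hausdorff k (badSet F E ε p R s) / ENNReal.ofReal s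
      ≤ ∫⁻ _ in Set.Ioc (R * μ ^ (n + 1)) (R * μ ^ n), H / ENNReal.ofReal (R * μ ^ (n + 1)) := by
        refine setLIntegral_mono' measurableSet_Ioc fun s hs => ?_
        have hs0 : 0 < s := hσ.trans hs.1
        refine ENNReal.div_le_div (measure_mono ?_) (ENNReal.ofReal_le_ofReal hs.1.le)
        refine badSet_subset hs0 hμ le_rfl hs.2 ?_
        calc R * μ ^ n * μ = R * μ ^ (n + 1) := by ring
          _ ≤ s := hs.1.le
    _ = H / ENNReal.ofReal (R * μ ^ (n + 1)) * ENNReal.ofReal (R * μ ^ n - R * μ ^ (n + 1)) := by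
        rw [setLIntegral_const, Real.volume_Ioc]
    _ ≤ H / ENNReal.ofReal (R * μ ^ (n + 1)) * ENNReal.ofReal (R * μ ^ n) := by
        gcongr
        linarith
    _ = ENNReal.ofReal μ⁻¹ * H := by
        have h1 : R * μ ^ n = R * μ ^ (n + 1) * μ⁻¹ := by
          rw [pow_succ]
          field_simp
        rw [h1, ENNReal.ofReal_mul hσ.le, ← mul_assoc, ENNReal.div_mul_cancel
          (by simpa using hσ) ENNReal.ofReal_ne_top, mul_comm]

/-- The sum over the scales `R μⁿ` with `n ≥ 1` is bounded by the Carleson integral. -/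
lemma tsum_badSet_le {F : Set (Heis k) → Prop} {E : Set (Heis k)} {p : Heis k} {R ε μ : ℝ}
    (hR : 0 < R) (hμ : 0 < μ) (hμ1 : μ < 1) :
    ENNReal.ofReal (1 - μ) * ∑' n : ℕ, hausdorff k (badSet F E ε p R (R * μ ^ (n + 1))) ≤
      ∫⁻ s in Set.Ioo 0 R, hausdorff k (badSet F E (μ * ε) p R s) / ENNReal.ofReal s := by
  have hanti : Antitone fun n : ℕ => R * μ ^ n := fun m n hmn => by
    have := pow_le_pow_of_le_one hμ.le hμ1.le hmn
    change R * μ ^ n ≤ R * μ ^ m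
    gcongr
  have hsub : (⋃ n : ℕ, Set.Ioo (R * μ ^ (n + 1)) (R * μ ^ n)) ⊆ Set.Ioo 0 R :=
    Set.iUnion_subset fun n => Set.Ioo_subset_Ioo (by positivity)
      (by simpa using hanti (Nat.zero_le n))
  refine le_trans ?_ (lintegral_mono_set hsub)
  have hdisj : Pairwise
      (Function.onFun Disjoint fun n : ℕ => Set.Ioo (R * μ ^ (n + 1)) (R * μ ^ n)) :=
    hanti.pairwise_disjoint_on_Ioo_succ
  rw [lintegral_iUnion (fun n => measurableSet_Ioo) hdisj, ← ENNReal.tsum_mul_left]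
  refine ENNReal.tsum_le_tsum fun n => ?_
  have hσ : 0 < R * μ ^ (n + 1) := by positivity
  have hσ' : 0 < R * μ ^ n := by positivity
  set H := hausdorff k (badSet F E ε p R (R * μ ^ (n + 1))) with hH
  calc ENNReal.ofReal (1 - μ) * H
      = H / ENNReal.ofReal (R * μ ^ n) * ENNReal.ofReal (R * μ ^ n - R * μ ^ (n + 1)) := by
        have h1 : R * μ ^ n - R * μ ^ (n + 1) = R * μ ^ n * (1 - μ) := by ring
        rw [h1, ENNReal.ofReal_mul hσ'.le, ← mul_assoc, ENNReal.div_mul_cancel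
          (by simpa using hσ') ENNReal.ofReal_ne_top, mul_comm]
    _ = ∫⁻ _ in Set.Ioo (R * μ ^ (n + 1)) (R * μ ^ n), H / ENNReal.ofReal (R * μ ^ n) := by
        rw [setLIntegral_const, Real.volume_Ioo]
    _ ≤ _ := by
        refine setLIntegral_mono' measurableSet_Ioo fun s hs => ?_
        refine ENNReal.div_le_div (measure_mono ?_) (ENNReal.ofReal_le_ofReal hs.2.le)
        refine badSet_subset hσ hμ le_rfl hs.1.le ?_
        calc s * μ ≤ R * μ ^ n * μ := by gcongr; exact hs.2.le
          _ = R * μ ^ (n + 1) := by ring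

lemma BWGL.exists_tsum_le {F : Set (Heis k) → Prop} {E : Set (Heis k)} (h : BWGL F E) {ε μ : ℝ}
    (hε : 0 < ε) (hμ : 0 < μ) (hμ1 : μ < 1) :
    ∃ C : ℝ, 0 < C ∧ ∀ p ∈ E, ∀ R : ℝ, 0 < R →
      ∑' n : ℕ, hausdorff k (badSet F E ε p R (R * μ ^ (n + 1))) ≤
        ENNReal.ofReal (C * R ^ (2 * k + 1)) := by
  obtain ⟨C, hC, hCE⟩ := h (μ * ε) (by positivity)
  have h1 : 0 < 1 - μ := by linarith
  refine ⟨C / (1 - μ), by positivity, fun p hp R hR => ?_⟩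
  have := (tsum_badSet_le hR hμ hμ1).trans (hCE p hp R hR)
  rw [mul_comm, ← ENNReal.le_div_iff_mul_le (Or.inl (by simpa using h1))
    (Or.inl ENNReal.ofReal_ne_top), ← ENNReal.ofReal_div_of_pos h1] at this
  refine this.trans_eq ?_
  congr 1
  ring

lemma bwgl_of_exists_tsum_le {F : Set (Heis k) → Prop} {E : Set (Heis k)}
    (h : ∀ ε : ℝ, 0 < ε → ∃ C : ℝ, 0 < C ∧ ∀ p ∈ E, ∀ R : ℝ, 0 < R →
      ∑' n : ℕ, hausdorff k (badSet F E ε p R (R * (1 / 2) ^ n)) ≤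
        ENNReal.ofReal (C * R ^ (2 * k + 1))) : BWGL F E := by
  intro ε hε
  obtain ⟨C, hC, hCE⟩ := h (1 / 2 * ε) (by positivity)
  refine ⟨(1 / 2)⁻¹ * C, by positivity, fun p hp R hR => ?_⟩
  refine (lintegral_badSet_le (μ := 1 / 2) hR (by norm_num) (by norm_num)).trans ?_
  rw [mul_assoc, ENNReal.ofReal_mul (by norm_num)]
  gcongr
  exact hCE p hp R hR

/-! ### From arbitrary to vertical hyperplanes -/

/-- The points at which vertical hyperplanes approximate `E` badly at the scale `R μ^(N+1)`, while
`bβ_E` is small at the scales `R μ^j` with `m ≤ j < N`. -/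
def badSince (E : Set (Heis k)) (ε μ R : ℝ) (m N : ℕ) : Set (Heis k) :=
  {q | q ∈ E ∧ ENNReal.ofReal ε < bilateralBeta IsVerticalHyperplane E q (R * μ ^ (N + 1)) ∧
    ∀ j, m ≤ j → j < N →
      bilateralBeta IsHyperplane E q (R * μ ^ j) ≤ ENNReal.ofReal (ε * μ ^ 2 / 16)}

lemma lt_bilateralBeta_of_mem_badSince {E : Set (Heis k)} {q : Heis k} {ε μ R : ℝ} {m N i : ℕ}
    (hε : 0 < ε) (hε1 : ε ≤ 1 / 16) (hμ : 0 < μ) (hμε : 1000 * μ ≤ ε) (hR : 0 < R)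
    (hq : q ∈ badSince E ε μ R m N) (hmi : m + 1 ≤ i) (hiN : i ≤ N + 1) :
    ENNReal.ofReal ε < bilateralBeta IsVerticalHyperplane E q (R * μ ^ i) := by
  refine Nat.decreasingInduction' (m := i) (n := N + 1)
    (P := fun i => ENNReal.ofReal ε < bilateralBeta IsVerticalHyperplane E q (R * μ ^ i))
    (fun j hjN hij ih => ?_) hiN hq.2.1
  obtain ⟨l, rfl⟩ : ∃ l, j = l + 1 := ⟨j - 1, by omega⟩
  have h2 : R * μ ^ (l + 1 + 1) = μ ^ 2 * (R * μ ^ l) := by ring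
  have h1 : R * μ ^ (l + 1) = μ * (R * μ ^ l) := by ring
  rw [h2] at ih
  rw [h1]
  exact lt_bilateralBeta_vertical_scale_up hε hε1 hμ hμε (by positivity) hq.1
    (hq.2.2 l (by omega) (by omega)) ih

/-- Two points at distance at most `R μ^m / 2` that have been bad since the scale `R μ^m` have at
each scale a common centre in their vicinity, and hence are at distance at most `R μ^N / 2`. -/
lemma dist_le_of_mem_badSince {E : Set (Heis k)} {x y : Heis k} {ε μ R : ℝ} {m N : ℕ}
    (hε : 0 < ε) (hε1 : ε ≤ 1 / 16) (hμ : 0 < μ) (hμε : 1000 * μ ≤ ε) (hR : 0 < R) (hmN : m ≤ N)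
    (hx : x ∈ badSince E ε μ R m N) (hy : y ∈ badSince E ε μ R m N)
    (hxy : dist x y ≤ R * μ ^ m / 2) : dist x y ≤ R * μ ^ N / 2 := by
  refine Nat.le_induction (m := m)
    (P := fun j _ => j ≤ N → dist x y ≤ R * μ ^ j / 2) (fun _ => hxy)
    (fun j hmj ih hjN => ?_) N hmN le_rfl
  have h2 : R * μ ^ (j + 2) = μ ^ 2 * (R * μ ^ j) := by ring
  have h1 : R * μ ^ (j + 1) = μ * (R * μ ^ j) := by ring
  have hbx := lt_bilateralBeta_of_mem_badSince hε hε1 hμ hμε hR hx (i := j + 2) (by omega)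
    (by omega)
  have hby := lt_bilateralBeta_of_mem_badSince hε hε1 hμ hμε hR hy (i := j + 2) (by omega)
    (by omega)
  rw [h2] at hbx hby
  rw [h1]
  exact dist_le_of_vertical_bad hε (by linarith) hμ hμε (by positivity) hy.1 hx.1 (ih (by omega))
    (hy.2.2 j hmj (by omega)) hby hbx

/-- The part of `E` around `p` that pays for the points which have been bad since the scale
`R μ^m`: all of it for `m = 0`, and otherwise the set where `bβ_E` is large at the scale
`R μ^(m-2)`, which comes next to the scale `R μ^(m-1)` at which the bad points have large `bβ_E`. -/
def payingSet (E : Set (Heis k)) (ε μ R : ℝ) (p : Heis k) : ℕ → Set (Heis k)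
  | 0 => closedBall p (R / μ ^ 3) ∩ E
  | m + 1 => badSet IsHyperplane E (μ * (ε * μ ^ 2 / 16)) p (R / μ ^ 3) (R * μ ^ m / μ)

/-- A point that is bad at the scale `R μ^(N+1)` has been bad since some scale `R μ^m`, where
`m = 0` or `bβ_E` is large at the scale `R μ^(m-1)`; then the paying set of index `m` contains a
neighbourhood in `E` of the point. -/
lemma exists_mem_badSince {E : Set (Heis k)} {p q : Heis k} {ε μ R : ℝ} (hμ : 0 < μ)
    (hμ2 : μ ≤ 1 / 2) (hR : 0 < R) (N : ℕ)
    (hq : q ∈ badSet IsVerticalHyperplane E ε p (R / μ) (R * μ ^ (N + 1))) :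
    ∃ m ≤ N, q ∈ badSince E ε μ R m N ∧
      closedBall q (R * μ ^ m / 10) ∩ E ⊆ payingSet E ε μ R p m := by
  classical
  set ε' := ε * μ ^ 2 / 16 with hε'
  let Q : ℕ → Prop := fun m =>
    ∀ j, m = j + 1 → ENNReal.ofReal ε' < bilateralBeta IsHyperplane E q (R * μ ^ j)
  have hQ0 : Q 0 := fun j hj => by omega
  set m := Nat.findGreatest Q N with hm
  have hQm : Q m := Nat.findGreatest_spec (Nat.zero_le N) hQ0
  have hmN : m ≤ N := Nat.findGreatest_le N
  refine ⟨m, hmN, ⟨hq.1.1, hq.2, fun j hmj hjN => ?_⟩, ?_⟩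
  · have hnot : ¬ Q (j + 1) := Nat.findGreatest_is_greatest (n := N) (by omega) (by omega)
    by_contra! hlt
    exact hnot fun i hi => by
      obtain rfl : j = i := by omega
      exact hlt
  · have hpow : ∀ j : ℕ, R * μ ^ j ≤ R := fun j =>
      mul_le_of_le_one_right hR.le (pow_le_one₀ hμ.le (by linarith))
    have hball : ∀ z, dist z q ≤ R → dist z p ≤ R / μ ^ 3 := by
      intro z hz
      have h1 : dist q p ≤ R / μ := hq.1.2
      have hR1 : R ≤ R / μ := by rw [le_div_iff₀ hμ]; nlinarith
      have h2 : 2 * (R / μ) ≤ R / μ ^ 3 := by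
        rw [le_div_iff₀ (by positivity)]
        have h3 : 2 * (R / μ) * μ ^ 3 = 2 * μ ^ 2 * R := by field_simp
        rw [h3]
        exact mul_le_of_le_one_left hR.le (by nlinarith)
      linarith [dist_triangle z q p]
    clear_value m
    rintro z ⟨hzq, hzE⟩
    have hzq' : dist z q ≤ R * μ ^ m / 10 := hzq
    have hzR : dist z q ≤ R := by
      have := hpow m
      linarith [dist_nonneg (x := z) (y := q)]
    rcases m with _ | m
    · exact ⟨hball z hzR, hzE⟩
    · have hσ : 0 < R * μ ^ m := by positivity
      refine ⟨⟨hzE, hball z hzR⟩, lt_bilateralBeta_of_scale hσ hμ ?_ ?_ (hQm m rfl)⟩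
      · rw [dist_comm, le_div_iff₀ hμ]
        have h1 : R * μ ^ (m + 1) = μ * (R * μ ^ m) := by ring
        rw [h1] at hzq'
        calc (dist z q + R * μ ^ m) * μ ≤ (R * μ ^ m + R * μ ^ m) * (1 / 2) := by
              gcongr
              nlinarith
          _ = R * μ ^ m := by ring
      · rw [div_mul_cancel₀ _ hμ.ne']

/-- The Carleson sum for vertical hyperplanes, at the scales `R μⁿ` below the diameter. -/
lemma tsum_vertical_le_of_lt_ediam {E : Set (Heis k)} {ε μ C c C₂ : ℝ} (hE : IsClosed E)
    (hε : 0 < ε) (hε1 : ε ≤ 1 / 16) (hμ : 0 < μ) (hμε : 1000 * μ ≤ ε) (hC : 0 < C) (hc : 0 < c)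
    (hC₂ : 0 < C₂)
    (hup : ∀ (p : Heis k) (r : ℝ), 0 < r →
      hausdorff k (closedBall p r ∩ E) ≤ ENNReal.ofReal (C * r ^ (2 * k + 1)))
    (hlow : ∀ p ∈ E, ∀ r : ℝ, 0 < r → ENNReal.ofReal r < ediam E →
      ENNReal.ofReal (c * r ^ (2 * k + 1)) ≤ hausdorff k (closedBall p r ∩ E))
    (hsum : ∀ p ∈ E, ∀ R : ℝ, 0 < R →
      ∑' n : ℕ, hausdorff k (badSet IsHyperplane E (μ * (ε * μ ^ 2 / 16)) p R (R * μ ^ (n + 1))) ≤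
        ENNReal.ofReal (C₂ * R ^ (2 * k + 1)))
    {p : Heis k} (hp : p ∈ E) {R : ℝ} (hR : 0 < R) (hRE : ENNReal.ofReal R < ediam E) :
    ∑' n : ℕ, hausdorff k (badSet IsVerticalHyperplane E ε p (R / μ) (R * μ ^ n)) ≤
      ENNReal.ofReal ((C / μ ^ (2 * k + 1) + 2 * (C / c * 5 ^ (2 * k + 1)) *
        ((C + C₂) / (μ ^ 3) ^ (2 * k + 1))) * R ^ (2 * k + 1)) := by
  set d := 2 * k + 1 with hd
  have hμ2 : μ ≤ 1 / 2 := by linarith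
  set K := C / c * 5 ^ d with hK
  have hK0 : 0 < K := by positivity
  set b : ℕ → ℝ≥0∞ := fun m => hausdorff k (payingSet E ε μ R p m) with hb
  have hR3 : 0 < R / μ ^ 3 := by positivity
  have hpay : ∀ m, payingSet E ε μ R p m ⊆ closedBall p (R / μ ^ 3) ∩ E := by
    rintro (_ | m)
    · exact subset_rfl
    · exact fun q hq => ⟨hq.1.2, hq.1.1⟩
  -- The estimate for one scale, from the covering lemma.
  have hstep : ∀ m i, hausdorff k {q | q ∈ badSince E ε μ R m (m + i) ∧
      closedBall q (R * μ ^ m / 10) ∩ E ⊆ payingSet E ε μ R p m} ≤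
      ENNReal.ofReal K * (b m * ENNReal.ofReal (μ ^ d) ^ i) := by
    intro m i
    set σ := R * μ ^ m with hσ
    have hσ0 : 0 < σ := by positivity
    have hσR : σ ≤ R := mul_le_of_le_one_right hR.le (pow_le_one₀ hμ.le (by linarith))
    have hτ : 0 < R * μ ^ (m + i) / 2 := by positivity
    have ha : 0 < c * (σ / 10) ^ d := by positivity
    have hmain := mul_measure_le_of_clustered (hausdorff k)
      (F := {q | q ∈ badSince E ε μ R m (m + i) ∧ closedBall q (σ / 10) ∩ E ⊆
        payingSet E ε μ R p m}) (G := payingSet E ε μ R p m)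
      (δ := σ / 10) (τ := R * μ ^ (m + i) / 2) (a := ENNReal.ofReal (c * (σ / 10) ^ d))
      (b := ENNReal.ofReal (C * (R * μ ^ (m + i) / 2) ^ d))
      hE.measurableSet (fun q hq => hq.1.1) (by positivity)
      (fun x hx y hy hxy => dist_le_of_mem_badSince hε hε1 hμ hμε hR (by omega) hx.1 hy.1
        (by linarith))
      (by simpa using ha)
      (fun x hx => hlow x hx.1.1 _ (by positivity)
        ((ENNReal.ofReal_le_ofReal (by linarith)).trans_lt hRE))
      (fun x _ => hup x _ hτ) (fun x hx => hx.2)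
      (ne_top_of_le_ne_top ENNReal.ofReal_ne_top ((measure_mono (hpay m)).trans (hup p _ hR3)))
    have hconst : C * (R * μ ^ (m + i) / 2) ^ d = c * (σ / 10) ^ d * (K * (μ ^ d) ^ i) := by
      have h1 : R * μ ^ (m + i) / 2 = 5 * (σ / 10) * μ ^ i := by
        rw [hσ, pow_add]
        ring
      rw [h1, mul_pow, mul_pow, ← pow_mul, mul_comm i d, pow_mul, hK]
      field_simp
    rw [hconst, ENNReal.ofReal_mul ha.le, mul_assoc, ENNReal.mul_le_mul_iff_right
      (by simpa using ha) ENNReal.ofReal_ne_top, ENNReal.ofReal_mul hK0.le,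
      ENNReal.ofReal_pow (by positivity)] at hmain
    refine hmain.trans_eq ?_
    ring
  have hN : ∀ N : ℕ, hausdorff k (badSet IsVerticalHyperplane E ε p (R / μ) (R * μ ^ (N + 1))) ≤
      ∑ x ∈ Finset.HasAntidiagonal.antidiagonal N,
        ENNReal.ofReal K * (b x.1 * ENNReal.ofReal (μ ^ d) ^ x.2) := by
    intro N
    refine le_trans (measure_mono fun q hq => ?_) ((measure_biUnion_finset_le
      (Finset.HasAntidiagonal.antidiagonal N) (fun x : ℕ × ℕ =>
        {q | q ∈ badSince E ε μ R x.1 (x.1 + x.2) ∧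
          closedBall q (R * μ ^ x.1 / 10) ∩ E ⊆ payingSet E ε μ R p x.1})).trans
      (Finset.sum_le_sum fun x _ => hstep x.1 x.2))
    obtain ⟨m, hmN, hm1, hm2⟩ := exists_mem_badSince hμ hμ2 hR N hq
    refine Set.mem_biUnion (x := (m, N - m)) (by simp; omega) ⟨?_, hm2⟩
    have : m + (N - m) = N := by omega
    simpa only [this] using hm1
  have hbsum : ∑' m, b m ≤ ENNReal.ofReal ((C + C₂) / (μ ^ 3) ^ d * R ^ d) := by
    have h1 : (C + C₂) / (μ ^ 3) ^ d * R ^ d = C * (R / μ ^ 3) ^ d + C₂ * (R / μ ^ 3) ^ d := by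
      rw [div_pow]
      ring
    rw [tsum_eq_zero_add' ENNReal.summable, h1, ENNReal.ofReal_add (by positivity) (by positivity)]
    refine add_le_add (hup p _ hR3) (le_trans ?_ (hsum p hp _ hR3))
    rw [tsum_eq_zero_add' (f := fun n => hausdorff k (badSet IsHyperplane E
      (μ * (ε * μ ^ 2 / 16)) p (R / μ ^ 3) (R / μ ^ 3 * μ ^ (n + 1)))) ENNReal.summable]
    refine le_add_left (ENNReal.tsum_le_tsum fun m => le_of_eq ?_)
    have h2 : R * μ ^ m / μ = R / μ ^ 3 * μ ^ (m + 1 + 1) := by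
      field_simp
      ring
    simp only [hb, payingSet, h2]
  have hgeom : ∑' i, ENNReal.ofReal (μ ^ d) ^ i ≤ ENNReal.ofReal 2 := by
    have := tsum_ofReal_geometric_le (c := 1) (a := 1) zero_le_one zero_le_one hμ.le hμ2 d
      (by omega)
    simp only [one_mul, mul_one, one_pow] at this
    refine le_trans (le_of_eq (tsum_congr fun i => ?_)) this
    rw [← ENNReal.ofReal_pow (by positivity), ← pow_mul, ← pow_mul, mul_comm]
  rw [tsum_eq_zero_add' ENNReal.summable, add_mul, ENNReal.ofReal_add (by positivity)
    (by positivity)]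
  refine add_le_add ?_ ?_
  · have hsub : badSet IsVerticalHyperplane E ε p (R / μ) (R * μ ^ 0) ⊆
        closedBall p (R / μ) ∩ E := fun q hq => ⟨hq.1.2, hq.1.1⟩
    refine (measure_mono hsub).trans ((hup p (R / μ) (by positivity)).trans_eq ?_)
    rw [div_pow]
    congr 1
    ring
  · calc _ ≤ ∑' N, ∑ x ∈ Finset.HasAntidiagonal.antidiagonal N,
          ENNReal.ofReal K * (b x.1 * ENNReal.ofReal (μ ^ d) ^ x.2) := ENNReal.tsum_le_tsum hN
      _ = ENNReal.ofReal K * ((∑' m, b m) * ∑' i, ENNReal.ofReal (μ ^ d) ^ i) := by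
          rw [ENNReal.tsum_mul_tsum_eq_tsum_sum_antidiagonal, ← ENNReal.tsum_mul_left]
          simp_rw [Finset.mul_sum]
      _ ≤ ENNReal.ofReal K *
          (ENNReal.ofReal ((C + C₂) / (μ ^ 3) ^ d * R ^ d) * ENNReal.ofReal 2) := by gcongr
      _ = _ := by
          rw [← ENNReal.ofReal_mul (by positivity), ← ENNReal.ofReal_mul hK0.le]
          congr 1
          ring

/-- The restriction to scales below the diameter is immaterial: at a scale `s ≥ diam E` the
trivial bound `C s^(2k+1)` for the mass of `E` is summable. -/
lemma tsum_vertical_le_of_forall_lt_ediam {E : Set (Heis k)} {ε μ C C₁ : ℝ} (hμ : 0 < μ)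
    (hμ2 : μ ≤ 1 / 2) (hC : 0 < C) (hC₁ : 0 < C₁)
    (hup : ∀ (p : Heis k) (r : ℝ), 0 < r →
      hausdorff k (closedBall p r ∩ E) ≤ ENNReal.ofReal (C * r ^ (2 * k + 1)))
    {p : Heis k} (hp : p ∈ E)
    (hsum : ∀ R : ℝ, 0 < R → ENNReal.ofReal R < ediam E →
      ∑' n : ℕ, hausdorff k (badSet IsVerticalHyperplane E ε p (R / μ) (R * μ ^ n)) ≤
        ENNReal.ofReal (C₁ * R ^ (2 * k + 1))) {S : ℝ} (hS : 0 < S) :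
    ∑' n : ℕ, hausdorff k (badSet IsVerticalHyperplane E ε p (S / μ) (S * μ ^ n)) ≤
      ENNReal.ofReal ((2 * C + C₁) * S ^ (2 * k + 1)) := by
  classical
  set d := 2 * k + 1 with hd
  have hfull : ∀ r : ℝ, 0 < r → ¬ ENNReal.ofReal r < ediam E → E ⊆ closedBall p r := by
    intro r hr0 hr q hq
    have h1 := (edist_le_ediam_of_mem hq hp).trans (not_lt.1 hr)
    rw [edist_dist] at h1
    exact (ENNReal.ofReal_le_ofReal_iff hr0.le).1 h1
  have htriv : ∀ n : ℕ, ¬ ENNReal.ofReal (S * μ ^ n) < ediam E →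
      hausdorff k (badSet IsVerticalHyperplane E ε p (S / μ) (S * μ ^ n)) ≤
        ENNReal.ofReal (C * (S * μ ^ n) ^ d) := by
    intro n hn
    have hσ : 0 < S * μ ^ n := by positivity
    have hsub : badSet IsVerticalHyperplane E ε p (S / μ) (S * μ ^ n) ⊆
        closedBall p (S * μ ^ n) ∩ E := fun q hq => ⟨hfull _ hσ hn hq.1.1, hq.1.1⟩
    exact (measure_mono hsub).trans (hup p _ hσ)
  have hgeom := tsum_ofReal_geometric_le hC.le hS.le hμ.le hμ2 d (by omega)
  rw [add_mul, ENNReal.ofReal_add (by positivity) (by positivity)]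
  by_cases hex : ∃ n : ℕ, ENNReal.ofReal (S * μ ^ n) < ediam E
  · set N := Nat.find hex with hN
    have hNlt : ENNReal.ofReal (S * μ ^ N) < ediam E := Nat.find_spec hex
    have hNmin : ∀ n < N, ¬ ENNReal.ofReal (S * μ ^ n) < ediam E := fun n hn => Nat.find_min hex hn
    clear_value N
    rw [← Summable.sum_add_tsum_nat_add' (k := N) ENNReal.summable]
    refine add_le_add ?_ ?_
    · refine le_trans (Finset.sum_le_sum fun n hn => htriv n (hNmin n (Finset.mem_range.1 hn))) ?_
      exact (ENNReal.sum_le_tsum _).trans hgeom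
    · have hpow : S * μ ^ N ≤ S := mul_le_of_le_one_right hS.le (pow_le_one₀ hμ.le (by linarith))
      refine le_trans (ENNReal.tsum_le_tsum fun n => measure_mono ?_)
        ((hsum (S * μ ^ N) (by positivity) hNlt).trans (ENNReal.ofReal_le_ofReal (by gcongr)))
      intro q hq
      have heq : S * μ ^ N * μ ^ n = S * μ ^ (n + N) := by ring
      refine ⟨⟨hq.1.1, ?_⟩, by rw [heq]; exact hq.2⟩
      rcases N with _ | N
      · simpa using hq.1.2
      · have h1 : S * μ ^ (N + 1) / μ = S * μ ^ N := by
          rw [pow_succ]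
          field_simp
        rw [h1]
        exact hfull _ (by positivity) (hNmin N (by omega)) hq.1.1
  · push Not at hex
    refine le_add_right (le_trans (ENNReal.tsum_le_tsum fun n => htriv n (hex n).not_gt) hgeom)

lemma tsum_eq_sum_tsum_mul_add {l : ℕ} [NeZero l] (f : ℕ → ℝ≥0∞) :
    ∑' n, f n = ∑ i : Fin l, ∑' n, f (n * l + i) := by
  rw [← (Nat.divModEquiv l).symm.tsum_eq, ← tsum_fintype (L := .unconditional _),
    ENNReal.tsum_comm, ← ENNReal.tsum_prod]
  rfl

/-- The bilateral weak geometric lemma for arbitrary hyperplanes yields the one for vertical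
hyperplanes. -/
lemma BWGL.vertical {E : Set (Heis k)} (hE : IsClosed E) (hreg : AhlforsRegular E)
    (h : BWGL IsHyperplane E) : BWGL IsVerticalHyperplane E := by
  obtain ⟨⟨C, hC, hup⟩, c, hc, hlow⟩ := hreg
  refine bwgl_of_exists_tsum_le fun ε₀ hε₀ => ?_
  set ε := min ε₀ (1 / 16) with hεdef
  have hε : 0 < ε := lt_min hε₀ (by norm_num)
  have hε1 : ε ≤ 1 / 16 := min_le_right _ _
  obtain ⟨l, hl⟩ := exists_pow_lt_of_lt_one (x := ε / 1000) (y := (1 / 2 : ℝ)) (by positivity)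
    (by norm_num)
  set μ : ℝ := (1 / 2) ^ l with hμdef
  have hμ : 0 < μ := by positivity
  have hμε : 1000 * μ ≤ ε := by linarith
  have hμ2 : μ ≤ 1 / 2 := by linarith
  have hl0 : l ≠ 0 := by
    rintro rfl
    norm_num [hμdef] at hμ2
  have : NeZero l := ⟨hl0⟩
  obtain ⟨C₂, hC₂, hsum⟩ := h.exists_tsum_le (ε := μ * (ε * μ ^ 2 / 16)) (μ := μ) (by positivity)
    hμ (by linarith)
  set C₁ := C / μ ^ (2 * k + 1) + 2 * (C / c * 5 ^ (2 * k + 1)) *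
        ((C + C₂) / (μ ^ 3) ^ (2 * k + 1)) with hC₁def
  have hC₁ : 0 < C₁ := by positivity
  refine ⟨l * (2 * C + C₁), by positivity, fun p hp R hR => ?_⟩
  -- The dyadic scales split into `l` geometric sequences of ratio `μ = 2⁻ˡ`.
  rw [tsum_eq_sum_tsum_mul_add (l := l)]
  have hi : ∀ i : Fin l, ∑' n : ℕ, hausdorff k
      (badSet IsVerticalHyperplane E ε₀ p R (R * (1 / 2) ^ (n * l + (i : ℕ)))) ≤
      ENNReal.ofReal ((2 * C + C₁) * R ^ (2 * k + 1)) := by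
    intro i
    set S := R * (1 / 2) ^ (i : ℕ) with hSdef
    have hS : 0 < S := by positivity
    have hSR : S ≤ R := mul_le_of_le_one_right hR.le (pow_le_one₀ (by norm_num) (by norm_num))
    have hRS : R ≤ S / μ := by
      rw [le_div_iff₀ hμ]
      exact mul_le_mul_of_nonneg_left
        (pow_le_pow_of_le_one (by norm_num) (by norm_num) i.2.le) hR.le
    refine le_trans (ENNReal.tsum_le_tsum fun n => measure_mono ?_)
      ((tsum_vertical_le_of_forall_lt_ediam (ε := ε) hμ hμ2 hC hC₁ hup hp (fun R' hR' hR'E =>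
        tsum_vertical_le_of_lt_ediam hE hε hε1 hμ hμε hC hc hC₂ hup hlow hsum hp hR' hR'E)
        hS).trans (ENNReal.ofReal_le_ofReal (by gcongr)))
    intro q hq
    have heq : S * μ ^ n = R * (1 / 2) ^ (n * l + (i : ℕ)) := by
      rw [hSdef, hμdef, ← pow_mul, pow_add, mul_comm n l]
      ring
    rw [heq]
    exact ⟨⟨hq.1.1, closedBall_subset_closedBall hRS hq.1.2⟩,
      (ENNReal.ofReal_le_ofReal (min_le_left _ _)).trans_lt hq.2⟩
  refine (Finset.sum_le_sum fun i _ => hi i).trans_eq ?_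
  rw [Finset.sum_const, Finset.card_univ, Fintype.card_fin, nsmul_eq_mul, mul_assoc (l : ℝ),
    ENNReal.ofReal_mul (p := (l : ℝ)) (by positivity), ENNReal.ofReal_natCast]

/-- Enlarging the family of approximating sets weakens the bilateral weak geometric lemma. -/
lemma BWGL.mono {F F' : Set (Heis k) → Prop} {E : Set (Heis k)} (h : ∀ P, F P → F' P)
    (hE : BWGL F E) : BWGL F' E := by
  intro ε hε
  obtain ⟨C, hC, hCE⟩ := hE ε hε
  refine ⟨C, hC, fun p hp R hR => le_trans (lintegral_mono fun s => ?_) (hCE p hp R hR)⟩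
  refine ENNReal.div_le_div_right (measure_mono fun q hq => ?_) _
  exact ⟨hq.1, hq.2.trans_le (bilateralBeta_anti h E q s)⟩

end Heis

theorem mainTheorem9 (k : ℕ) (hk : 1 ≤ k) (E : Set (Heis k)) (hE : IsClosed E)
    (hreg : Heis.AhlforsRegular E) :
    Heis.BWGL Heis.IsVerticalHyperplane E ↔ Heis.BWGL Heis.IsHyperplane E :=
  ⟨Heis.BWGL.mono fun _ => Heis.IsVerticalHyperplane.isHyperplane,
    Heis.BWGL.vertical hE hreg⟩
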